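/- For $r\ge 2$ let $\mathrm{ITM}(r)\subset\mathbb R^{2r-1}$ be the set of parameters $(\gamma_1,\dots,\gamma_r,\beta_1,\dots,\beta_{r-1})$ with $0=\beta_0<\beta_1<\dots<\beta_{r-1}<\beta_r=1$ and $-\beta_{i-1}\le\gamma_i\le 1-\beta_i$ for $1\le i\le r$. Each such parameter defines the interval translation map (ITM) $T\colon I\to I$, $I=[0,1)$, $T(x)=x+\gamma_i$ for $x\in[\beta_{i-1},\beta_i)$. Put $X_n=T^n(I)$ and let $X=\bigcap_{n\ge0}X_n$ be the attractor of $T$. The map $T$ is of finite type if $X_{n+1}=X_n=X$ for some $n$, and of infinite type if $X_{n+1}\subsetneq X_n$ for all $n$. An interval component of $X$ is a connected component $J$ of $X$, and the return map to $J$ is $R_J(x)=T^{k}(x)$, where $k\ge1$ is the smallest integer with $T^k(x)\in J$. Assume the Boshernitzan–Kornfeld Conjecture: for every $r\ge2$, the set of infinite type maps in $\mathrm{ITM}(r)$ has Lebesgue measure zero in $\mathbb R^{2r-1}$. Then for every $r\ge2$ and Lebesgue-almost every $T\in\mathrm{ITM}(r)$: $T$ is of finite type, and for every interval component $J$ of its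 attractor $X$ the return map $R_J$ is defined on all of $J$ and is isomorphic to an irrational circle rotation; that is, $J=[a,b)$ with $a<b$, and there is an irrational $\alpha$ such that the affine identification $z\mapsto\frac{z-a}{b-a}\bmod 1$ of $[a,b)$ with $\mathbb R/\mathbb Z$ conjugates $R_J\colon J\to J$ to the rotation $\theta\mapsto\theta+\alpha$. -/

import Mathlib

open Set MeasureTheory

noncomputable section

namespace IntervalTranslation

/-- Parameter vectors `(γ, β)`: translation factors `γ₁, …, γᵣ` (with `γ i` standing for `γ_{i+1}`)
and discontinuities `β₁, …, β_{r-1}` (with `β j` standing for `β_{j+1}`). The space is `ℝ^{2r-1}` and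
carries Lebesgue measure as `volume`. -/
abbrev Param (r : ℕ) : Type := (Fin r → ℝ) × (Fin (r - 1) → ℝ)

/-- The partition points `β₀ = 0`, `β₁, …, β_{r-1}`, `βᵣ = 1`. -/
def breakpoint {r : ℕ} (p : Param r) (i : ℕ) : ℝ :=
  if i = 0 then 0 else if h : i - 1 < r - 1 then p.2 ⟨i - 1, h⟩ else 1

/-- The `i`-th partition interval `[β_{i-1}, β_i)` (indices shifted by one). -/
def piece {r : ℕ} (p : Param r) (i : Fin r) : Set ℝ :=
  Ico (breakpoint p i) (breakpoint p (i + 1))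

/-- The parameter space of interval translation maps on `r` intervals:
`0 = β₀ < β₁ < ⋯ < βᵣ = 1` and `-β_{i-1} ≤ γ_i ≤ 1 - β_i`. -/
def ITM (r : ℕ) : Set (Param r) :=
  {p | (∀ i : Fin r, breakpoint p i < breakpoint p (i + 1)) ∧
    ∀ i : Fin r, -breakpoint p i ≤ p.1 i ∧ p.1 i ≤ 1 - breakpoint p (i + 1)}

/-- The interval translation map `x ↦ x + γ_i` for `x ∈ [β_{i-1}, β_i)`. It is written as a map of
`ℝ` (the identity off `[0,1)`); only its values on `[0,1)` are used below. -/
def toMap {r : ℕ} (p : Param r) (x : ℝ) : ℝ :=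
  x + ∑ i : Fin r, (piece p i).indicator (fun _ => p.1 i) x

/-- `X_n = T^n(I)` with `I = [0,1)`. -/
def iterImage {r : ℕ} (p : Param r) (n : ℕ) : Set ℝ :=
  (toMap p)^[n] '' Ico 0 1

/-- The attractor `X = ⋂_n T^n(I)`. -/
def attractor {r : ℕ} (p : Param r) : Set ℝ :=
  ⋂ n : ℕ, iterImage p n

/-- Finite type: `X_{n+1} = X_n = X` for some `n`. -/
def IsFiniteType {r : ℕ} (p : Param r) : Prop :=
  ∃ n : ℕ, iterImage p (n + 1) = iterImage p n ∧ iterImage p n = attractor p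

/-- Infinite type: `X_{n+1} ⊊ X_n` for all `n`. -/
def IsInfiniteType {r : ℕ} (p : Param r) : Prop :=
  ∀ n : ℕ, iterImage p (n + 1) ⊂ iterImage p n

/-- The Boshernitzan–Kornfeld Conjecture. -/
def BoshernitzanKornfeldConjecture : Prop :=
  ∀ r : ℕ, 2 ≤ r → volume {p : Param r | p ∈ ITM r ∧ IsInfiniteType p} = 0

/-- `J` is an interval component of `X`, that is, a connected component of `X`. -/
def IsIntervalComponent (X J : Set ℝ) : Prop :=
  ∃ x ∈ X, J = connectedComponentIn X x

/-- Every point of `J` returns to `J` under `T`. -/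
def Returns (T : ℝ → ℝ) (J : Set ℝ) : Prop :=
  ∀ x ∈ J, ∃ k : ℕ, 1 ≤ k ∧ T^[k] x ∈ J

/-- The first return time to `J`: the least `k ≥ 1` with `T^k(x) ∈ J` (if there is one). -/
def returnTime (T : ℝ → ℝ) (J : Set ℝ) (x : ℝ) : ℕ :=
  sInf {k : ℕ | 1 ≤ k ∧ T^[k] x ∈ J}

/-- The first return map `R_J(x) = T^k(x)`, `k` the first return time. -/
def returnMap (T : ℝ → ℝ) (J : Set ℝ) (x : ℝ) : ℝ :=
  T^[returnTime T J x] x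

/-- The map `z ↦ (z - a) / (b - a) mod 1`, the orientation-preserving affine identification of
`[a, b)` with the circle `ℝ/ℤ`. -/
def toCircle (a b z : ℝ) : UnitAddCircle :=
  (((z - a) / (b - a) : ℝ) : UnitAddCircle)

/-- The identification of `[a, b)` with `ℝ/ℤ` is bijective. -/
theorem bijOn_toCircle {a b : ℝ} (hab : a < b) : BijOn (toCircle a b) (Ico a b) univ := by
  have hb : 0 < b - a := sub_pos.2 hab
  refine ⟨fun _ _ => mem_univ _, ?_, ?_⟩
  · intro z hz w hw h
    have key : ∀ u ∈ Ico a b, (u - a) / (b - a) ∈ Ico (0 : ℝ) (0 + 1) := fun u hu =>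
      ⟨div_nonneg (sub_nonneg.2 hu.1) hb.le, by
        rw [zero_add, div_lt_one hb]; linarith [hu.2]⟩
    have h2 := (AddCircle.coe_eq_coe_iff_of_mem_Ico (p := (1 : ℝ)) (a := 0) (key z hz) (key w hw)).1 h
    have h3 := (div_left_inj' hb.ne').1 h2
    linarith
  · intro c _
    obtain ⟨t, ht, rfl⟩ := AddCircle.eq_coe_Ico (p := (1 : ℝ)) c
    refine ⟨a + t * (b - a), ⟨by nlinarith [ht.1], by nlinarith [ht.2]⟩, ?_⟩
    simp only [toCircle]
    congr 1
    field_simp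
    ring

/-- `R : J → J` is isomorphic to an irrational circle rotation: `J = [a, b)` and the affine
identification of `[a, b)` with `ℝ/ℤ` conjugates `R` to `θ ↦ θ + α` for an irrational `α`. -/
def IsIrrationalRotation (R : ℝ → ℝ) (J : Set ℝ) : Prop :=
  ∃ a b α : ℝ, a < b ∧ J = Ico a b ∧ Irrational α ∧
    ∀ z ∈ J, R z ∈ J ∧ toCircle a b (R z) = toCircle a b z + (α : UnitAddCircle)

/-- The map is of finite type, and the return map to every interval component of its attractor is
defined on the whole component and isomorphic to an irrational circle rotation. -/
def CorrespondsToIrrationalRotation {r : ℕ} (p : Param r) : Prop :=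
  IsFiniteType p ∧ ∀ J : Set ℝ, IsIntervalComponent (attractor p) J →
    Returns (toMap p) J ∧ IsIrrationalRotation (returnMap (toMap p) J) J

end IntervalTranslation

end

/-!
Almost every parameter vector `(γ, β)` is linearly independent over `ℚ`, and, given the
Boshernitzan–Kornfeld Conjecture, almost every map is of finite type. For such a map the attractor
`X` is a finite union of half-open intervals, and `T` restricts to a bijection of `X`: it maps `X`
onto itself without increasing the measure of subsets (`IsFiniteType.injOn_attractor`).

The heart of the proof is a supply of `T`-invariant functions. Write `1_X` as the step function with
jump divisor `d`, which is `+1` at left and `-1` at right end points of `X`, and let `φ : ℝ → ℚ` be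
a `ℚ`-linear functional with `φ(γ_i) = 0` for all `i`. Then the step function `N` with divisor
`e ↦ φ(e) d(e)` is invariant under `T`, vanishes off `X`, is constant on the components of `X`, and
equals `φ(β_j)` at each `β_j ∈ X` (`exists_invariant_of_linearMap`). Choosing `φ(β_k) = δ_{jk}`
gives invariants that tell the discontinuities apart (`exists_invariant`).

Consequently all orbits that start in one component `J` of `X` can meet only one discontinuity
`β_j`, and, `T` being injective on `X`, only one point of `J` meets it before returning to `J`
(`IsBreak.unique`). So `J` splits into at most two intervals on which the return map is a
translation (`exists_returnMap_eq_add`); the return exists because otherwise the images of such an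
interval would be disjoint and of equal length. An injective self-map of `[a, b)` of this kind
without periodic points must exchange two intervals, hence is an irrational rotation
(`exchange_of_injOn`, `isIrrationalRotation_of_exchange`). There are no periodic points because
`T^k x - x` is a sum of `k` of the independent numbers `γ_i` (`IsGeneric.iterate_ne`).
-/

open Set MeasureTheory

noncomputable section

namespace IntervalTranslation

/-! ### Step functions and their jump divisors -/

/-- The right-continuous step function with jump `d e` at each point `e`, vanishing near `-∞`:
`step d τ = ∑_{e ≤ τ} d e`. The finitely supported function `d` is called its jump divisor. -/
def step : (ℝ →₀ ℚ) →ₗ[ℚ] (ℝ → ℚ) :=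
  Finsupp.linearCombination ℚ fun e τ => if e ≤ τ then (1 : ℚ) else 0

/-- The translate of a divisor by `g`. -/
def shift (g : ℝ) : (ℝ →₀ ℚ) →ₗ[ℚ] (ℝ →₀ ℚ) :=
  Finsupp.lmapDomain ℚ ℚ fun e => e + g

/-- The product of a divisor with a function of the position. -/
def twist (φ : ℝ → ℚ) : (ℝ →₀ ℚ) →ₗ[ℚ] (ℝ →₀ ℚ) :=
  Finsupp.linearCombination ℚ fun e => Finsupp.single e (φ e)

/-- The total mass of a divisor. -/
def total : (ℝ →₀ ℚ) →ₗ[ℚ] ℚ :=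
  Finsupp.linearCombination ℚ fun _ => 1

lemma step_single (e : ℝ) (c : ℚ) (τ : ℝ) :
    step (Finsupp.single e c) τ = if e ≤ τ then c else 0 := by
  simp [step]

lemma step_eq_sum (d : ℝ →₀ ℚ) (τ : ℝ) :
    step d τ = ∑ e ∈ d.support, if e ≤ τ then d e else 0 := by
  simp [step, Finsupp.linearCombination_apply, Finsupp.sum, Finset.sum_apply]

lemma step_shift (g : ℝ) (d : ℝ →₀ ℚ) (τ : ℝ) : step (shift g d) τ = step d (τ - g) := by
  induction d using Finsupp.induction_linear with
  | zero => simp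
  | add f g hf hg => simp [hf, hg]
  | single a b => simp [shift, Finsupp.mapDomain_single, step_single, le_sub_iff_add_le]

lemma twist_single (φ : ℝ → ℚ) (e : ℝ) (c : ℚ) :
    twist φ (Finsupp.single e c) = Finsupp.single e (φ e * c) := by
  simp [twist, mul_comm]

lemma twist_apply (φ : ℝ → ℚ) (d : ℝ →₀ ℚ) (e : ℝ) : twist φ d e = φ e * d e := by
  induction d using Finsupp.induction_linear with
  | zero => simp
  | add f g hf hg => simp [hf, hg, mul_add]
  | single a b =>
    rw [twist_single]
    rcases eq_or_ne a e with rfl | h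
    · simp
    · simp [Finsupp.single_eq_of_ne' h]

lemma total_eq_sum (d : ℝ →₀ ℚ) : total d = ∑ e ∈ d.support, d e := by
  simp [total, Finsupp.linearCombination_apply, Finsupp.sum]

lemma twist_shift (φ : ℝ →ₗ[ℚ] ℚ) {g : ℝ} (hg : φ g = 0) (d : ℝ →₀ ℚ) :
    twist φ (shift g d) = shift g (twist φ d) := by
  induction d using Finsupp.induction_linear with
  | zero => simp
  | add f g hf hg => simp [hf, hg]
  | single a b =>
    simp only [shift, Finsupp.lmapDomain_apply, Finsupp.mapDomain_single, twist_single, map_add, hg,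
      add_zero]

/-- If `φ` is invariant under translation by `g`, then translating a divisor changes its
`φ η`-mass by a multiple of its `φ`-mass. -/
lemma total_twist_mul_shift (φ η : ℝ →ₗ[ℚ] ℚ) {g : ℝ} (hg : φ g = 0) (d : ℝ →₀ ℚ) :
    total (twist (fun e => φ e * η e) (shift g d)) =
      total (twist (fun e => φ e * η e) d) + η g * total (twist φ d) := by
  induction d using Finsupp.induction_linear with
  | zero => simp
  | add f g hf hg => simp only [map_add, hf, hg]; ring
  | single a b =>
    simp only [shift, Finsupp.lmapDomain_apply, Finsupp.mapDomain_single, twist_single, map_add, hg,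
      total, Finsupp.linearCombination_single, smul_eq_mul]
    ring

lemma step_eq_of_forall_Ioc {d : ℝ →₀ ℚ} {x y : ℝ} (hxy : x ≤ y)
    (h : ∀ e ∈ Ioc x y, d e = 0) : step d y = step d x := by
  rw [step_eq_sum, step_eq_sum]
  refine Finset.sum_congr rfl fun e _ => ?_
  by_cases h1 : e ≤ x
  · simp [h1, h1.trans hxy]
  · by_cases h2 : e ≤ y
    · simp [h1, h2, h e ⟨not_le.1 h1, h2⟩]
    · simp [h1, h2]

lemma step_eq_zero_of_forall_le {d : ℝ →₀ ℚ} {x : ℝ} (h : ∀ e ≤ x, d e = 0) : step d x = 0 := by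
  rw [step_eq_sum]
  exact Finset.sum_eq_zero fun e _ => by split_ifs with h1 <;> simp [*]

lemma step_eq_total {d : ℝ →₀ ℚ} {x : ℝ} (h : ∀ e, x < e → d e = 0) : step d x = total d := by
  rw [step_eq_sum, total_eq_sum]
  refine Finset.sum_congr rfl fun e _ => ?_
  split_ifs with h1
  · rfl
  · exact (h e (not_le.1 h1)).symm

lemma exists_step_eq_right (d : ℝ →₀ ℚ) (x : ℝ) :
    ∃ y, x < y ∧ ∀ z ∈ Ico x y, step d z = step d x := by
  have h : ∀ᶠ y in nhdsWithin x (Ioi x), ∀ e ∈ d.support, e ∉ Ioc x y := by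
    rw [Filter.eventually_all_finset]
    intro e _
    by_cases he : x < e
    · filter_upwards [Ioo_mem_nhdsGT he] with y hy h
      exact absurd h.2 (not_le.2 hy.2)
    · exact Filter.Eventually.of_forall fun y h => he h.1
  obtain ⟨y, hy, hxy⟩ := (h.and self_mem_nhdsWithin).exists
  refine ⟨y, hxy, fun z hz => step_eq_of_forall_Ioc hz.1 fun e he => ?_⟩
  by_contra hd
  exact hy e (Finsupp.mem_support_iff.2 hd) ⟨he.1, he.2.trans hz.2.le⟩

/-- The jump of `step d` at `x` is `d x`. -/
lemma exists_step_add_eq_left (d : ℝ →₀ ℚ) (x : ℝ) :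
    ∃ y, y < x ∧ ∀ z ∈ Ico y x, step d z + d x = step d x := by
  have h : ∀ᶠ y in nhdsWithin x (Iio x), ∀ e ∈ d.support, e ∉ Ioo y x := by
    rw [Filter.eventually_all_finset]
    intro e _
    by_cases he : e < x
    · filter_upwards [Ioo_mem_nhdsLT he] with y hy h
      exact absurd h.1 (not_lt.2 hy.1.le)
    · exact Filter.Eventually.of_forall fun y h => he h.2
  obtain ⟨y, hy, hxy⟩ := (h.and self_mem_nhdsWithin).exists
  refine ⟨y, hxy, fun z hz => ?_⟩
  have h1 : step (d.erase x) x = step (d.erase x) z := by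
    refine step_eq_of_forall_Ioc hz.2.le fun e he => ?_
    rcases eq_or_ne e x with rfl | hex
    · simp
    · rw [Finsupp.erase_ne hex]
      by_contra hd
      exact hy e (Finsupp.mem_support_iff.2 hd)
        ⟨hz.1.trans_lt he.1, lt_of_le_of_ne he.2 hex⟩
  have h2 : ∀ t, step d t = step (d.erase x) t + if x ≤ t then d x else 0 := fun t => by
    conv_lhs => rw [← Finsupp.erase_add_single x d]
    rw [map_add, Pi.add_apply, step_single]
  rw [h2 z, h2 x, h1]
  simp [not_le.2 hz.2]

/-- A divisor vanishes on an open interval on which its step function is constant. -/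
lemma apply_eq_zero_of_step_eq {d : ℝ →₀ ℚ} {c : ℚ} {x y : ℝ} (hxy : x < y)
    (h : ∀ z ∈ Icc x y, step d z = c) : d y = 0 := by
  obtain ⟨w, hw, hz⟩ := exists_step_add_eq_left d y
  have := hz (max w x) ⟨le_max_left _ _, max_lt hw hxy⟩
  rw [h _ ⟨le_max_right _ _, (max_lt hw hxy).le⟩, h _ ⟨hxy.le, le_rfl⟩] at this
  linarith

lemma step_injective : Function.Injective step := by
  rw [← LinearMap.ker_eq_bot, LinearMap.ker_eq_bot']
  intro d hd
  ext x
  exact apply_eq_zero_of_step_eq (c := 0) (sub_one_lt x) fun z _ => by rw [hd]; rfl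

/-- The functions with a jump divisor are closed under multiplication. -/
lemma exists_step_eq_mul (d d' : ℝ →₀ ℚ) : ∃ d'', step d'' = step d * step d' := by
  induction d using Finsupp.induction_linear with
  | zero => exact ⟨0, by simp⟩
  | add f g hf hg =>
    obtain ⟨a, ha⟩ := hf
    obtain ⟨b, hb⟩ := hg
    exact ⟨a + b, by rw [map_add, map_add, ha, hb, add_mul]⟩
  | single u s =>
    induction d' using Finsupp.induction_linear with
    | zero => exact ⟨0, by simp⟩
    | add f g hf hg =>
      obtain ⟨a, ha⟩ := hf
      obtain ⟨b, hb⟩ := hg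
      exact ⟨a + b, by rw [map_add, map_add, ha, hb, mul_add]⟩
    | single v t =>
      refine ⟨Finsupp.single (max u v) (s * t), ?_⟩
      ext τ
      simp only [step_single, Pi.mul_apply, max_le_iff]
      by_cases h1 : u ≤ τ <;> by_cases h2 : v ≤ τ <;> simp [h1, h2]

/-- A set is elementary if its indicator function has a jump divisor; equivalently, if it is a
finite union of half-open intervals `[u, v)`, `v = ∞` being allowed. -/
def IsElementary (E : Set ℝ) : Prop :=
  ∃ d, step d = E.indicator 1

lemma isElementary_empty : IsElementary ∅ := ⟨0, by ext; simp⟩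

lemma isElementary_Ico (u v : ℝ) : IsElementary (Ico u v) := by
  rcases lt_or_ge u v with h | h
  · refine ⟨Finsupp.single u 1 - Finsupp.single v 1, ?_⟩
    ext τ
    simp only [map_sub, Pi.sub_apply, step_single, indicator_apply, mem_Ico, Pi.one_apply]
    by_cases h1 : v ≤ τ
    · simp [h1, h.le.trans h1]
    · simp [h1, not_le.1 h1]
  · rw [Ico_eq_empty_of_le h]
    exact isElementary_empty

lemma IsElementary.inter {E F : Set ℝ} (hE : IsElementary E) (hF : IsElementary F) :
    IsElementary (E ∩ F) := by
  obtain ⟨d, hd⟩ := hE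
  obtain ⟨d', hd'⟩ := hF
  obtain ⟨e, he⟩ := exists_step_eq_mul d d'
  exact ⟨e, by rw [he, hd, hd', Set.inter_indicator_one]⟩

lemma IsElementary.union {E F : Set ℝ} (hE : IsElementary E) (hF : IsElementary F) :
    IsElementary (E ∪ F) := by
  obtain ⟨e, he⟩ := hE.inter hF
  obtain ⟨d, hd⟩ := hE
  obtain ⟨d', hd'⟩ := hF
  refine ⟨d + d' - e, ?_⟩
  rw [map_sub, map_add, he, hd, hd', sub_eq_iff_eq_add, Set.indicator_union_add_inter]

lemma IsElementary.iUnion {ι : Type*} [Finite ι] {E : ι → Set ℝ} (h : ∀ i, IsElementary (E i)) :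
    IsElementary (⋃ i, E i) := by
  rw [← biUnion_univ]
  refine Set.Finite.induction_on (motive := fun s _ => IsElementary (⋃ i ∈ s, E i)) _
    Set.finite_univ (by simpa using isElementary_empty) fun _ _ ih => ?_
  rw [biUnion_insert]
  exact (h _).union ih

lemma IsElementary.image_add_const {E : Set ℝ} (hE : IsElementary E) (g : ℝ) :
    IsElementary ((fun x => x + g) '' E) := by
  obtain ⟨d, hd⟩ := hE
  refine ⟨shift g d, ?_⟩
  ext τ
  rw [step_shift, hd, Set.image_add_right, sub_eq_add_neg]
  rfl

lemma step_eq_one_iff {E : Set ℝ} {d : ℝ →₀ ℚ} (hd : step d = E.indicator 1) {x : ℝ} :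
    step d x = 1 ↔ x ∈ E := by
  rw [hd]
  by_cases h : x ∈ E <;> simp [h]

lemma IsElementary.exists_Ico_subset {E : Set ℝ} (hE : IsElementary E) {x : ℝ} (hx : x ∈ E) :
    ∃ y, x < y ∧ Ico x y ⊆ E := by
  obtain ⟨d, hd⟩ := hE
  obtain ⟨y, hxy, h⟩ := exists_step_eq_right d x
  exact ⟨y, hxy, fun z hz => (step_eq_one_iff hd).1 ((h z hz).trans ((step_eq_one_iff hd).2 hx))⟩

lemma IsElementary.exists_Ico_disjoint {E : Set ℝ} (hE : IsElementary E) {x : ℝ} (hx : x ∉ E) :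
    ∃ y, x < y ∧ Disjoint (Ico x y) E := by
  obtain ⟨d, hd⟩ := hE
  obtain ⟨y, hxy, h⟩ := exists_step_eq_right d x
  refine ⟨y, hxy, Set.disjoint_left.2 fun z hz hzE => hx ?_⟩
  exact (step_eq_one_iff hd).1 ((h z hz).symm.trans ((step_eq_one_iff hd).2 hzE))

/-- The connected components of a bounded elementary set are half-open intervals. -/
lemma IsElementary.exists_connectedComponentIn_eq_Ico {E : Set ℝ} (hE : IsElementary E)
    (hb : Bornology.IsBounded E) {x : ℝ} (hx : x ∈ E) :
    ∃ a b, a < b ∧ connectedComponentIn E x = Ico a b := by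
  set J := connectedComponentIn E x with hJ
  have hJE : J ⊆ E := connectedComponentIn_subset E x
  have hxJ : x ∈ J := mem_connectedComponentIn hx
  have hord : J.OrdConnected := isPreconnected_connectedComponentIn.ordConnected
  have hJb : Bornology.IsBounded J := hb.subset hJE
  have hglue : ∀ {u v w : ℝ}, w ∈ J → w ∈ Ico u v → Ico u v ⊆ E → Ico u v ⊆ J := by
    intro u v w hw hwu hE'
    rw [hJ, connectedComponentIn_eq hw]
    exact isPreconnected_Ico.subset_connectedComponentIn hwu hE'
  have ha : sInf J ∈ J := by
    obtain ⟨y, hy, hyE⟩ : ∃ y, sInf J < y ∧ Ico (sInf J) y ⊆ E := by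
      refine hE.exists_Ico_subset ?_
      by_contra hna
      obtain ⟨y, hy, hdis⟩ := hE.exists_Ico_disjoint hna
      obtain ⟨z, hz, hzy⟩ := exists_lt_of_csInf_lt ⟨x, hxJ⟩ hy
      exact Set.disjoint_left.1 hdis ⟨csInf_le hJb.bddBelow hz, hzy⟩ (hJE hz)
    obtain ⟨z, hz, hzy⟩ := exists_lt_of_csInf_lt ⟨x, hxJ⟩ hy
    exact hglue hz ⟨csInf_le hJb.bddBelow hz, hzy⟩ hyE ⟨le_rfl, hy⟩
  have hbJ : sSup J ∉ J := fun h => by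
    obtain ⟨y, hy, hyE⟩ := hE.exists_Ico_subset (hJE h)
    have h1 := hglue h ⟨le_rfl, hy⟩ hyE (show (sSup J + y) / 2 ∈ Ico (sSup J) y by
      constructor <;> linarith)
    have := le_csSup hJb.bddAbove h1
    linarith
  have hJ' : J = Ico (sInf J) (sSup J) := by
    refine Set.Subset.antisymm (fun z hz => ⟨csInf_le hJb.bddBelow hz, ?_⟩) fun z hz => ?_
    · exact lt_of_le_of_ne (le_csSup hJb.bddAbove hz) fun h => hbJ (h ▸ hz)
    · obtain ⟨w, hw, hzw⟩ := exists_lt_of_lt_csSup ⟨x, hxJ⟩ hz.2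
      exact hord.out ha hw ⟨hz.1, hzw.le⟩
  refine ⟨sInf J, sSup J, ?_, hJ'⟩
  rw [hJ'] at hxJ
  exact hxJ.1.trans_lt hxJ.2


/-! ### The partition and the images of an interval translation map -/

section Basic

variable {r : ℕ} {p : Param r}

lemma breakpoint_zero : breakpoint p 0 = 0 := by simp [breakpoint]

lemma breakpoint_self (hr : 2 ≤ r) : breakpoint p r = 1 := by
  simp [breakpoint, show r ≠ 0 by omega]

lemma breakpoint_succ (j : Fin (r - 1)) : breakpoint p (j + 1) = p.2 j := by
  simp [breakpoint]

lemma breakpoint_lt (hp : p ∈ ITM r) {i j : ℕ} (hij : i < j) (hj : j ≤ r) :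
    breakpoint p i < breakpoint p j := by
  induction j, hij using Nat.le_induction with
  | base => exact hp.1 ⟨i, hj⟩
  | succ k hk ih => exact (ih (by omega)).trans (hp.1 ⟨k, hj⟩)

lemma breakpoint_le (hp : p ∈ ITM r) {i j : ℕ} (hij : i ≤ j) (hj : j ≤ r) :
    breakpoint p i ≤ breakpoint p j := by
  rcases hij.eq_or_lt with rfl | h
  · exact le_rfl
  · exact (breakpoint_lt hp h hj).le

lemma eq_of_mem_piece (hp : p ∈ ITM r) {x : ℝ} {i j : Fin r} (hi : x ∈ piece p i)
    (hj : x ∈ piece p j) : i = j := by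
  wlog h : i < j generalizing i j
  · rcases (not_lt.1 h).eq_or_lt with h | h
    · exact h.symm
    · exact (this hj hi h).symm
  have := breakpoint_le hp (show (i : ℕ) + 1 ≤ j from h) j.2.le
  exact absurd (hi.2.trans_le this) (not_lt.2 hj.1)

lemma piece_subset_Ico (hr : 2 ≤ r) (hp : p ∈ ITM r) (i : Fin r) : piece p i ⊆ Ico 0 1 := by
  intro x hx
  constructor
  · rw [← breakpoint_zero (p := p)]
    exact (breakpoint_le hp (Nat.zero_le _) i.2.le).trans hx.1
  · rw [← breakpoint_self (p := p) hr]
    exact hx.2.trans_le (breakpoint_le hp i.2 le_rfl)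

lemma exists_mem_piece (hr : 2 ≤ r) {x : ℝ} (hx : x ∈ Ico (0 : ℝ) 1) : ∃ i, x ∈ piece p i := by
  have h : ∀ n ≤ r, x < breakpoint p n → ∃ i, x ∈ piece p i := by
    intro n
    induction n with
    | zero => intro _ h; rw [breakpoint_zero] at h; exact absurd hx.1 (not_le.2 h)
    | succ k ih =>
      intro hk h
      by_cases h' : x < breakpoint p k
      · exact ih (by omega) h'
      · exact ⟨⟨k, hk⟩, not_lt.1 h', h⟩
  exact h r le_rfl (by rw [breakpoint_self hr]; exact hx.2)

lemma toMap_of_mem (hp : p ∈ ITM r) {x : ℝ} {i : Fin r} (hi : x ∈ piece p i) :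
    toMap p x = x + p.1 i := by
  rw [toMap, Finset.sum_eq_single i]
  · rw [indicator_of_mem hi]
  · exact fun j _ hj => indicator_of_notMem (fun h => hj (eq_of_mem_piece hp h hi)) _
  · simp

lemma mapsTo_toMap (hr : 2 ≤ r) (hp : p ∈ ITM r) : MapsTo (toMap p) (Ico 0 1) (Ico 0 1) := by
  intro x hx
  obtain ⟨i, hi⟩ := exists_mem_piece (p := p) hr hx
  rw [toMap_of_mem hp hi]
  have := hp.2 i
  exact ⟨by linarith [hi.1], by linarith [hi.2]⟩

lemma toMap_image_eq (hr : 2 ≤ r) (hp : p ∈ ITM r) {E : Set ℝ} (hE : E ⊆ Ico 0 1) :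
    toMap p '' E = ⋃ i, (fun x => x + p.1 i) '' (E ∩ piece p i) := by
  ext y
  simp only [mem_image, mem_iUnion]
  constructor
  · rintro ⟨x, hx, rfl⟩
    obtain ⟨i, hi⟩ := exists_mem_piece (p := p) hr (hE hx)
    exact ⟨i, x, ⟨hx, hi⟩, (toMap_of_mem hp hi).symm⟩
  · rintro ⟨i, x, ⟨hx, hi⟩, rfl⟩
    exact ⟨x, hx, toMap_of_mem hp hi⟩

lemma isElementary_piece (i : Fin r) : IsElementary (piece p i) := isElementary_Ico _ _

lemma iterImage_succ (n : ℕ) : iterImage p (n + 1) = toMap p '' iterImage p n := by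
  rw [iterImage, Function.iterate_succ', image_comp, iterImage]

lemma iterImage_subset_Ico (hr : 2 ≤ r) (hp : p ∈ ITM r) (n : ℕ) : iterImage p n ⊆ Ico 0 1 :=
  image_subset_iff.2 ((mapsTo_toMap hr hp).iterate n)

lemma iterImage_succ_subset (hr : 2 ≤ r) (hp : p ∈ ITM r) (n : ℕ) :
    iterImage p (n + 1) ⊆ iterImage p n := by
  rw [iterImage, Function.iterate_succ, image_comp, iterImage]
  exact image_mono (mapsTo_toMap hr hp).image_subset

lemma isElementary_iterImage (hr : 2 ≤ r) (hp : p ∈ ITM r) (n : ℕ) :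
    IsElementary (iterImage p n) := by
  induction n with
  | zero => simpa [iterImage] using isElementary_Ico 0 1
  | succ n ih =>
    rw [iterImage_succ, toMap_image_eq hr hp (iterImage_subset_Ico hr hp n)]
    exact .iUnion fun i => (ih.inter (isElementary_piece i)).image_add_const _

lemma isFiniteType_of_not_isInfiniteType (hr : 2 ≤ r) (hp : p ∈ ITM r)
    (h : ¬IsInfiniteType p) : IsFiniteType p := by
  obtain ⟨n, hn⟩ := not_forall.1 h
  have heq : iterImage p (n + 1) = iterImage p n := by
    by_contra hne
    exact hn ((iterImage_succ_subset hr hp n).ssubset_of_ne hne)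
  refine ⟨n, heq, Subset.antisymm (subset_iInter fun m => ?_) (iInter_subset _ n)⟩
  rcases le_total n m with hm | hm
  · refine Eq.subset ?_
    induction m, hm using Nat.le_induction with
    | base => rfl
    | succ k _ ih => rw [iterImage_succ, ← ih, ← iterImage_succ, heq]
  · exact antitone_nat_of_succ_le (fun k => iterImage_succ_subset hr hp k) hm

lemma IsFiniteType.image_attractor (h : IsFiniteType p) :
    toMap p '' attractor p = attractor p := by
  obtain ⟨n, h1, h2⟩ := h
  rw [← h2, ← iterImage_succ, h1]

lemma IsFiniteType.isElementary_attractor (hr : 2 ≤ r) (hp : p ∈ ITM r) (h : IsFiniteType p) :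
    IsElementary (attractor p) := by
  obtain ⟨n, _, h2⟩ := h
  rw [← h2]
  exact isElementary_iterImage hr hp n

lemma attractor_subset_Ico (hr : 2 ≤ r) (hp : p ∈ ITM r) : attractor p ⊆ Ico 0 1 :=
  (iInter_subset _ 0).trans (iterImage_subset_Ico hr hp 0)

lemma IsElementary.measurableSet {E : Set ℝ} (hE : IsElementary E) : MeasurableSet E := by
  obtain ⟨d, hd⟩ := hE
  have h : E = {x | step d x = 1} := by
    ext x
    exact (step_eq_one_iff hd).symm
  have hm : Measurable (step d) := by
    rw [show step d = fun τ => ∑ e ∈ d.support, if e ≤ τ then d e else 0 from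
      funext (step_eq_sum d)]
    exact Finset.measurable_sum _ fun e _ =>
      Measurable.ite measurableSet_Ici measurable_const measurable_const
  rw [h]
  exact hm (measurableSet_singleton 1)

lemma volume_toMap_image_le (hr : 2 ≤ r) (hp : p ∈ ITM r) {E : Set ℝ} (hE : E ⊆ Ico 0 1)
    (hm : MeasurableSet E) : volume (toMap p '' E) ≤ volume E := by
  have hE' : E = ⋃ i, E ∩ piece p i := by
    rw [← inter_iUnion, eq_comm, inter_eq_left]
    exact fun x hx => mem_iUnion.2 (exists_mem_piece hr (hE hx))
  calc volume (toMap p '' E)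
      ≤ ∑ i, volume ((fun x => x + p.1 i) '' (E ∩ piece p i)) := by
        rw [toMap_image_eq hr hp hE]
        exact measure_iUnion_fintype_le _ _
    _ = ∑ i, volume (E ∩ piece p i) :=
        Finset.sum_congr rfl fun i _ => by rw [image_add_right, measure_preimage_add_right]
    _ = volume E := by
        conv_rhs => rw [hE']
        rw [measure_iUnion, tsum_fintype]
        · exact fun i j hij => Set.disjoint_left.2 fun x hi hj =>
            hij (eq_of_mem_piece hp hi.2 hj.2)
        · exact fun i => hm.inter measurableSet_Ico

/-- On the attractor of a finite type map, `T` is injective: two points with the same image would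
be left end points of two disjoint intervals with the same image, and `T` would decrease the
measure of the attractor. -/
lemma IsFiniteType.injOn_attractor (hr : 2 ≤ r) (hp : p ∈ ITM r) (h : IsFiniteType p) :
    InjOn (toMap p) (attractor p) := by
  intro x hx y hy hxy
  by_contra hne
  wlog hlt : x < y generalizing x y
  · exact this hy hx hxy.symm (Ne.symm hne) (lt_of_le_of_ne (not_lt.1 hlt) (Ne.symm hne))
  have hI := attractor_subset_Ico hr hp
  have hel := h.isElementary_attractor hr hp
  obtain ⟨i, hi⟩ := exists_mem_piece (p := p) hr (hI hx)
  obtain ⟨j, hj⟩ := exists_mem_piece (p := p) hr (hI hy)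
  obtain ⟨u, hu, hux⟩ := (hel.inter (isElementary_piece i)).exists_Ico_subset ⟨hx, hi⟩
  obtain ⟨v, hv, hvy⟩ := (hel.inter (isElementary_piece j)).exists_Ico_subset ⟨hy, hj⟩
  obtain ⟨ε, hε, hεm⟩ : ∃ ε, 0 < ε ∧ ε ≤ min (min (u - x) (v - y)) (y - x) :=
    ⟨_, by simp [hu, hv, hlt], le_rfl⟩
  simp only [le_min_iff] at hεm
  have hsub : Ico y (y + ε) ⊆ attractor p := fun z hz =>
    (hvy ⟨hz.1, by linarith [hz.2]⟩).1
  have himg : toMap p '' (attractor p \ Ico y (y + ε)) = attractor p := by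
    refine Subset.antisymm ((image_mono sdiff_subset).trans h.image_attractor.subset) ?_
    intro z hz
    rw [← h.image_attractor] at hz
    obtain ⟨w, hw, rfl⟩ := hz
    by_cases hwy : w ∈ Ico y (y + ε)
    · have h1 : x + (w - y) ∈ Ico x u := ⟨by linarith [hwy.1], by linarith [hwy.2]⟩
      refine ⟨x + (w - y), ⟨(hux h1).1, fun h2 => ?_⟩, ?_⟩
      · linarith [h2.1, hwy.2]
      · rw [toMap_of_mem hp (hux h1).2,
          toMap_of_mem hp (hvy ⟨hwy.1, by linarith [hwy.2]⟩).2]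
        rw [toMap_of_mem hp hi, toMap_of_mem hp hj] at hxy
        linarith
    · exact ⟨w, ⟨hw, hwy⟩, rfl⟩
  have hle := volume_toMap_image_le hr hp (sdiff_subset.trans hI)
    (hel.measurableSet.diff (measurableSet_Ico (a := y) (b := y + ε)))
  have hfin : volume (attractor p) ≠ ⊤ :=
    ((measure_mono hI).trans_lt (by simp)).ne
  rw [himg, measure_sdiff hsub measurableSet_Ico.nullMeasurableSet (by simp)] at hle
  refine absurd hle (not_le.2 (ENNReal.sub_lt_self hfin ?_ (by simpa using hε)))
  exact ((by simpa using hε : 0 < volume (Ico y (y + ε))).trans_le (measure_mono hsub)).ne'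

end Basic


/-! ### Rationally independent parameters -/

/-- The parameters `γ₁, …, γᵣ, β₁, …, β_{r-1}` are linearly independent over `ℚ`. -/
def IsGeneric {r : ℕ} (p : Param r) : Prop :=
  LinearIndependent ℚ (Sum.elim p.1 p.2)

/-- The parameters satisfying a given nontrivial rational relation form a proper subspace. -/
lemma ae_isGeneric (r : ℕ) : ∀ᵐ p : Param r, IsGeneric p := by
  have h : ∀ g : Fin r ⊕ Fin (r - 1) → ℚ, g ≠ 0 →
      ∀ᵐ p : Param r, ∑ i, g i • Sum.elim p.1 p.2 i ≠ 0 := by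
    intro g hg
    let L : Param r →ₗ[ℝ] ℝ :=
      { toFun := fun p => ∑ i, g i • Sum.elim p.1 p.2 i
        map_add' := fun p q => by
          simp only [Fintype.sum_sum_type, Sum.elim_inl, Sum.elim_inr, Prod.fst_add, Prod.snd_add,
            Pi.add_apply, smul_add, Finset.sum_add_distrib]
          ring
        map_smul' := fun c p => by
          simp only [Fintype.sum_sum_type, Sum.elim_inl, Sum.elim_inr, Prod.smul_fst,
            Prod.smul_snd, Pi.smul_apply, RingHom.id_apply, smul_add, Finset.smul_sum,
            smul_comm c] }
    have hL : LinearMap.ker L ≠ ⊤ := by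
      intro htop
      refine hg (funext fun i => ?_)
      have hz : ∀ q, L q = 0 := fun q => LinearMap.mem_ker.1 (htop ▸ Submodule.mem_top)
      rcases i with i | j
      · simpa [L, Pi.single_apply, Rat.smul_def] using hz (Pi.single i 1, 0)
      · simpa [L, Pi.single_apply, Rat.smul_def] using hz (0, Pi.single j 1)
    have : (volume : Measure (Param r)).IsAddHaarMeasure :=
      Measure.prod.instIsAddHaarMeasure (volume : Measure (Fin r → ℝ))
        (volume : Measure (Fin (r - 1) → ℝ))
    have := Measure.addHaar_submodule (volume : Measure (Param r)) (LinearMap.ker L) hL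
    rw [ae_iff]
    refine measure_mono_null (fun p hp => ?_) this
    simpa [L] using hp
  have h' : ∀ᵐ p : Param r, ∀ g : Fin r ⊕ Fin (r - 1) → ℚ, g ≠ 0 →
      ∑ i, g i • Sum.elim p.1 p.2 i ≠ 0 := by
    rw [ae_all_iff]
    intro g
    by_cases hg : g = 0
    · exact Filter.Eventually.of_forall fun p h => absurd hg h
    · filter_upwards [h g hg] with p hp _ using hp
  filter_upwards [h'] with p hp
  refine Fintype.linearIndependent_iff.2 fun g hg i => ?_
  by_contra hi
  exact hp g (fun h0 => hi (by rw [h0]; rfl)) hg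

lemma _root_.LinearIndependent.exists_linearMap_apply_eq {K V W ι : Type*} [Field K]
    [AddCommGroup V] [Module K V] [AddCommGroup W] [Module K W] {v : ι → V}
    (hv : LinearIndependent K v) (f : ι → W) : ∃ φ : V →ₗ[K] W, ∀ i, φ (v i) = f i := by
  obtain ⟨φ, hφ⟩ := LinearMap.exists_extend
    ((Finsupp.linearCombination K f).comp hv.repr)
  refine ⟨φ, fun i => ?_⟩
  have := LinearMap.congr_fun hφ ⟨v i, Submodule.subset_span ⟨i, rfl⟩⟩
  simpa [hv.repr_eq_single i ⟨v i, Submodule.subset_span ⟨i, rfl⟩⟩ rfl] using this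

lemma IsGeneric.exists_linearMap {r : ℕ} {p : Param r} (hg : IsGeneric p) (f : Fin r → ℚ)
    (g : Fin (r - 1) → ℚ) :
    ∃ φ : ℝ →ₗ[ℚ] ℚ, (∀ i, φ (p.1 i) = f i) ∧ ∀ j, φ (p.2 j) = g j := by
  obtain ⟨φ, hφ⟩ := LinearIndependent.exists_linearMap_apply_eq hg (Sum.elim f g)
  exact ⟨φ, fun i => hφ (.inl i), fun j => hφ (.inr j)⟩

/-- A generic map has no periodic points: a `ℚ`-linear functional equal to `1` on all `γ_i` grows
by `1` at each step. -/
lemma IsGeneric.iterate_ne {r : ℕ} {p : Param r} (hg : IsGeneric p) (hr : 2 ≤ r) (hp : p ∈ ITM r)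
    {x : ℝ} (hx : x ∈ Ico (0 : ℝ) 1) {k : ℕ} (hk : 1 ≤ k) : (toMap p)^[k] x ≠ x := by
  obtain ⟨φ, hφ, -⟩ := hg.exists_linearMap (fun _ => 1) 0
  have h : ∀ n : ℕ, φ ((toMap p)^[n] x) = φ x + n := by
    intro n
    induction n with
    | zero => simp
    | succ n ih =>
      obtain ⟨i, hi⟩ := exists_mem_piece (p := p) hr ((mapsTo_toMap hr hp).iterate n hx)
      rw [Function.iterate_succ_apply', toMap_of_mem hp hi, map_add, ih, hφ]
      push_cast
      ring
  intro heq
  have h1 := h k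
  rw [heq, left_eq_add, Nat.cast_eq_zero] at h1
  omega

/-! ### The invariant attached to a discontinuity -/

/-- A weighted form of the invariance of the attractor `X`. Let `d` be the jump divisor of `1_X` and
`φ` a `ℚ`-linear functional vanishing on the translation factors. The step function `N` with jump
divisor `φ d` is invariant under `T`: restricted to the `i`-th piece it is the step function with
divisor `φ dᵢ`, where `dᵢ` is the divisor of `X ∩ [β_{i-1}, β_i)`, because the divisor `φ dᵢ` has
total mass zero (`hmass`); and the identity `d = ∑ dᵢ = ∑ (dᵢ translated by γᵢ)`, which expresses
that `T` permutes `X`, may be multiplied by `φ`. Being invariant, `N` vanishes outside `X`. -/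
theorem exists_invariant_of_linearMap {r : ℕ} {p : Param r} (hr : 2 ≤ r) (hp : p ∈ ITM r)
    (hfin : IsFiniteType p) (hg : IsGeneric p) (φ : ℝ →ₗ[ℚ] ℚ) (hφ : ∀ i, φ (p.1 i) = 0) :
    ∃ N : ℝ → ℚ, (∀ x ∈ attractor p, N (toMap p x) = N x) ∧
      (∀ x y, x ≤ y → Icc x y ⊆ attractor p → N y = N x) ∧
      ∀ j, p.2 j ∈ attractor p → N (p.2 j) = φ (p.2 j) := by
  have hinj := hfin.injOn_attractor hr hp
  have himg := hfin.image_attractor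
  have hI := attractor_subset_Ico hr hp
  have hel := hfin.isElementary_attractor hr hp
  set X := attractor p with hX
  choose d hd using fun i => hel.inter (isElementary_piece (p := p) i)
  obtain ⟨D, hD⟩ := hel
  have hsum : D = ∑ i, d i := by
    refine step_injective (funext fun τ => ?_)
    rw [map_sum, Finset.sum_apply]
    by_cases hτ : τ ∈ X
    · obtain ⟨i, hi⟩ := exists_mem_piece (p := p) hr (hI hτ)
      rw [Finset.sum_eq_single i, (step_eq_one_iff hD).2 hτ, (step_eq_one_iff (hd i)).2 ⟨hτ, hi⟩]
      · intro j _ hj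
        rw [hd, indicator_of_notMem]
        exact fun h => hj (eq_of_mem_piece hp h.2 hi)
      · simp
    · rw [hD, indicator_of_notMem hτ, Finset.sum_eq_zero]
      intro j _
      rw [hd, indicator_of_notMem fun h => hτ h.1]
  have hsum' : D = ∑ i, shift (p.1 i) (d i) := by
    refine step_injective (funext fun τ => ?_)
    rw [map_sum, Finset.sum_apply]
    simp only [step_shift]
    by_cases hτ : τ ∈ X
    · obtain ⟨σ, hσ, hστ⟩ := himg.symm.subset hτ
      obtain ⟨i, hi⟩ := exists_mem_piece (p := p) hr (hI hσ)
      have hσ' : τ - p.1 i = σ := by rw [← hστ, toMap_of_mem hp hi]; ring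
      rw [Finset.sum_eq_single i, (step_eq_one_iff hD).2 hτ, hσ',
        (step_eq_one_iff (hd i)).2 ⟨hσ, hi⟩]
      · intro j _ hj
        rw [hd, indicator_of_notMem]
        intro h
        have h1 : toMap p (τ - p.1 j) = τ := by rw [toMap_of_mem hp h.2]; ring
        have h2 : τ - p.1 j = σ := hinj h.1 hσ (h1.trans hστ.symm)
        exact hj (eq_of_mem_piece hp (h2 ▸ h.2) hi)
      · simp
    · rw [hD, indicator_of_notMem hτ, Finset.sum_eq_zero]
      intro j _
      rw [hd, indicator_of_notMem]
      intro h
      refine hτ (himg.subset ⟨_, h.1, ?_⟩)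
      rw [toMap_of_mem hp h.2]
      ring
  have hmass : ∀ i, total (twist φ (d i)) = 0 := by
    intro i
    obtain ⟨η, hη, -⟩ := hg.exists_linearMap (Pi.single i 1) 0
    -- Weighting both expressions for `D` with `φ η` isolates the `φ`-mass of `d i`.
    have h := congrArg (fun d => total (twist (fun e => φ e * η e) d)) (hsum.symm.trans hsum')
    simp only [map_sum, total_twist_mul_shift φ η (hφ _), Finset.sum_add_distrib, hη,
      Pi.single_apply, ite_mul, one_mul, zero_mul, Finset.sum_ite_eq', Finset.mem_univ,
      if_true] at h
    linarith
  have hbelow : ∀ (i : Fin r) (e : ℝ), e < breakpoint p i → d i e = 0 := fun i e he =>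
    apply_eq_zero_of_step_eq (c := 0) (sub_one_lt e) fun z hz => by
      rw [hd, indicator_of_notMem]
      exact fun h => absurd (hz.2.trans_lt he) (not_lt.2 h.2.1)
  have habove : ∀ (i : Fin r) (e : ℝ), breakpoint p (i + 1) < e → d i e = 0 := fun i e he =>
    apply_eq_zero_of_step_eq (c := 0) he fun z hz => by
      rw [hd, indicator_of_notMem]
      exact fun h => absurd hz.1 (not_le.2 h.2.2)
  have hsupp : ∀ i τ, τ ∉ piece p i → step (twist φ (d i)) τ = 0 := by
    intro i τ hτ
    rcases lt_or_ge τ (breakpoint p i) with h | h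
    · exact step_eq_zero_of_forall_le fun e he => by
        rw [twist_apply, hbelow i e (he.trans_lt h), mul_zero]
    · rw [step_eq_total, hmass]
      intro e he
      rw [twist_apply, habove i e, mul_zero]
      exact (not_lt.1 fun h' => hτ ⟨h, h'⟩).trans_lt he
  have hN : ∀ i τ, τ ∈ piece p i → step (twist φ D) τ = step (twist φ (d i)) τ := by
    intro i τ hτ
    rw [hsum, map_sum, map_sum, Finset.sum_apply, Finset.sum_eq_single i]
    · exact fun j _ hj => hsupp j τ fun h => hj (eq_of_mem_piece hp h hτ)
    · simp
  have hN' : ∀ τ, step (twist φ D) τ = ∑ i, step (twist φ (d i)) (τ - p.1 i) := by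
    intro τ
    rw [hsum', map_sum, map_sum, Finset.sum_apply]
    exact Finset.sum_congr rfl fun i _ => by rw [twist_shift φ (hφ i), step_shift]
  have hmem : ∀ τ, step (twist φ D) τ ≠ 0 → τ ∈ X := by
    intro τ hτ
    refine mem_iInter.2 fun n => ?_
    induction n generalizing τ with
    | zero =>
      obtain ⟨i, -, hi⟩ : ∃ i ∈ Finset.univ, step (twist φ (d i)) τ ≠ 0 := by
        refine Finset.exists_ne_zero_of_sum_ne_zero ?_
        rwa [hsum, map_sum, map_sum, Finset.sum_apply] at hτ
      simpa [iterImage] using piece_subset_Ico hr hp i (by_contra fun h => hi (hsupp i τ h))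
    | succ n ih =>
      rw [hN'] at hτ
      obtain ⟨i, -, hi⟩ := Finset.exists_ne_zero_of_sum_ne_zero hτ
      have hi' : τ - p.1 i ∈ piece p i := by_contra fun h => hi (hsupp i _ h)
      rw [iterImage_succ]
      refine ⟨τ - p.1 i, ih _ (by rwa [hN i _ hi']), ?_⟩
      rw [toMap_of_mem hp hi']
      ring
  refine ⟨step (twist φ D), fun x hx => ?_, fun x y hxy h => ?_, fun j hj => ?_⟩
  · obtain ⟨i, hi⟩ := exists_mem_piece (p := p) hr (hI hx)
    have hx' : toMap p x - p.1 i = x := by rw [toMap_of_mem hp hi]; ring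
    rw [hN', Finset.sum_eq_single i, hx', hN i x hi]
    · intro j _ hj
      by_contra hne
      have hj' : toMap p x - p.1 j ∈ piece p j := by_contra fun h => hne (hsupp j _ h)
      have h1 : toMap p (toMap p x - p.1 j) = toMap p x := by rw [toMap_of_mem hp hj']; ring
      have h2 : toMap p x - p.1 j = x := hinj (hmem _ (by rwa [hN j _ hj'])) hx h1
      exact hj (eq_of_mem_piece hp (h2 ▸ hj') hi)
    · simp
  · refine step_eq_of_forall_Ioc hxy fun e he => ?_
    rw [twist_apply, apply_eq_zero_of_step_eq (c := 1) he.1, mul_zero]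
    exact fun z hz => (step_eq_one_iff hD).2 (h ⟨hz.1, hz.2.trans he.2⟩)
  · set i : Fin r := ⟨j + 1, by omega⟩ with hi
    have hbr : breakpoint p i = p.2 j := breakpoint_succ j
    have hji : p.2 j ∈ piece p i := ⟨hbr.le, hbr ▸ hp.1 i⟩
    have key : ∀ d' : ℝ →₀ ℚ, (∀ e < p.2 j, d' e = 0) → step d' (p.2 j) = d' (p.2 j) := by
      intro d' hd'
      obtain ⟨y, hy, h⟩ := exists_step_add_eq_left d' (p.2 j)
      rw [← h y ⟨le_rfl, hy⟩, step_eq_zero_of_forall_le fun e he => hd' e (he.trans_lt hy),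
        zero_add]
    have hb : ∀ e < p.2 j, d i e = 0 := fun e he => hbelow i e (hbr ▸ he)
    rw [hN i _ hji, key _ fun e he => by rw [twist_apply, hb e he, mul_zero], twist_apply,
      ← key _ hb, (step_eq_one_iff (hd i)).2 ⟨hj, hji⟩, mul_one]

/-- Distinct discontinuities in the attractor are separated by a `T`-invariant function that is
constant on the components of the attractor. -/
theorem exists_invariant {r : ℕ} {p : Param r} (hr : 2 ≤ r) (hp : p ∈ ITM r)
    (hfin : IsFiniteType p) (hg : IsGeneric p) (j : Fin (r - 1)) :
    ∃ N : ℝ → ℚ, (∀ x ∈ attractor p, N (toMap p x) = N x) ∧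
      (∀ x y, x ≤ y → Icc x y ⊆ attractor p → N y = N x) ∧
      ∀ k, p.2 k ∈ attractor p → N (p.2 k) = if k = j then 1 else 0 := by
  obtain ⟨φ, hφ, hφ'⟩ := hg.exists_linearMap 0 (Pi.single j 1)
  obtain ⟨N, h1, h2, h3⟩ := exists_invariant_of_linearMap hr hp hfin hg φ hφ
  exact ⟨N, h1, h2, fun k hk => by rw [h3 k hk, hφ', Pi.single_apply]⟩


/-! ### First return maps -/

section Return

variable {T : ℝ → ℝ} {X J : Set ℝ}

lemma returnTime_spec {x : ℝ} (h : ∃ k : ℕ, 1 ≤ k ∧ T^[k] x ∈ J) :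
    1 ≤ returnTime T J x ∧ returnMap T J x ∈ J :=
  Nat.sInf_mem (s := {k : ℕ | 1 ≤ k ∧ T^[k] x ∈ J}) h

lemma notMem_of_lt_returnTime {x : ℝ} {t : ℕ} (ht : 1 ≤ t) (h : t < returnTime T J x) :
    T^[t] x ∉ J :=
  fun hJ => Nat.notMem_of_lt_sInf h ⟨ht, hJ⟩

lemma returnMap_eq {x : ℝ} {k : ℕ} (hk : 1 ≤ k) (hkJ : T^[k] x ∈ J)
    (h : ∀ t, 1 ≤ t → t < k → T^[t] x ∉ J) : returnMap T J x = T^[k] x := by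
  have hmem : k ∈ {k : ℕ | 1 ≤ k ∧ T^[k] x ∈ J} := ⟨hk, hkJ⟩
  have : returnTime T J x = k := le_antisymm (Nat.sInf_le hmem) <| not_lt.1 fun hlt =>
    h _ (Nat.sInf_mem ⟨k, hmem⟩).1 hlt (Nat.sInf_mem ⟨k, hmem⟩).2
  rw [returnMap, this]

lemma iterate_sub_eq (hinj : InjOn T X) (hmaps : MapsTo T X X) {x y : ℝ} (hx : x ∈ X)
    (hy : y ∈ X) {k l : ℕ} (hkl : k ≤ l) (h : T^[k] x = T^[l] y) : x = T^[l - k] y := by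
  refine hinj.iterate hmaps k hx (hmaps.iterate _ hy) ?_
  rw [h, ← Function.iterate_add_apply, Nat.add_sub_cancel' hkl]

lemma injOn_returnMap (hinj : InjOn T X) (hmaps : MapsTo T X X) (hJ : J ⊆ X)
    (hret : Returns T J) : InjOn (returnMap T J) J := by
  intro x hx y hy hxy
  wlog hle : returnTime T J x ≤ returnTime T J y generalizing x y
  · exact (this hy hx hxy.symm (le_of_not_ge hle)).symm
  have h := iterate_sub_eq hinj hmaps (hJ hx) (hJ hy) hle hxy
  rcases Nat.eq_zero_or_pos (returnTime T J y - returnTime T J x) with h0 | h0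
  · rwa [h0] at h
  · have := (returnTime_spec (hret x hx)).1
    exact absurd (h ▸ hx) (notMem_of_lt_returnTime h0 (by omega))

lemma exists_iterate_returnMap_eq (hret : Returns T J) {x : ℝ} (hx : x ∈ J) (q : ℕ) :
    ∃ m, q ≤ m ∧ (returnMap T J)^[q] x = T^[m] x ∧ (returnMap T J)^[q] x ∈ J := by
  induction q with
  | zero => exact ⟨0, le_rfl, rfl, hx⟩
  | succ q ih =>
    obtain ⟨m, hm, h1, h2⟩ := ih
    obtain ⟨h3, h4⟩ := returnTime_spec (hret _ h2)
    refine ⟨returnTime T J ((returnMap T J)^[q] x) + m, by omega, ?_, ?_⟩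
    · rw [Function.iterate_succ_apply', Function.iterate_add_apply, ← h1]
      rfl
    · rwa [Function.iterate_succ_apply']

end Return

/-! ### Bijections of an interval with at most one discontinuity -/

/-- A translation of a half-open interval into itself is trivial. -/
lemma eq_zero_of_add_mem_Ico {a b δ : ℝ} (hab : a < b)
    (h : ∀ z ∈ Ico a b, z + δ ∈ Ico a b) : δ = 0 := by
  have h1 := h a ⟨le_rfl, hab⟩
  by_contra hne
  have hpos : 0 < δ := lt_of_le_of_ne (by linarith [h1.1]) (Ne.symm hne)
  have h2 := h (b - δ) ⟨by linarith [h1.2], by linarith⟩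
  linarith [h2.2]

lemma add_le_of_add_mem_Ico {a b u v δ : ℝ} (huv : u < v)
    (h : ∀ z ∈ Ico u v, z + δ ∈ Ico a b) : a ≤ u + δ ∧ v + δ ≤ b := by
  refine ⟨(h u ⟨le_rfl, huv⟩).1, ?_⟩
  by_contra! hlt
  have h1 := h (max u (b - δ)) ⟨le_max_left _ _, max_lt huv (by linarith)⟩
  linarith [h1.2, le_max_right u (b - δ)]

/-- An injective map of `[a, b)` without fixed points that is a translation on `[a, y)` and on
`[y, b)` exchanges these two intervals. -/
lemma exchange_of_injOn {a b y δ₁ δ₂ : ℝ} {R : ℝ → ℝ} (hy : y ∈ Ioo a b)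
    (hinj : InjOn R (Ico a b)) (hfix : ∀ z ∈ Ico a b, R z ≠ z)
    (h1 : ∀ z ∈ Ico a y, R z = z + δ₁ ∧ z + δ₁ ∈ Ico a b)
    (h2 : ∀ z ∈ Ico y b, R z = z + δ₂ ∧ z + δ₂ ∈ Ico a b) :
    δ₁ = b - y ∧ δ₂ = a - y := by
  obtain ⟨ha, hb⟩ := hy
  obtain ⟨l1, u1⟩ := add_le_of_add_mem_Ico ha fun z hz => (h1 z hz).2
  obtain ⟨l2, u2⟩ := add_le_of_add_mem_Ico hb fun z hz => (h2 z hz).2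
  have n1 : δ₁ ≠ 0 := fun h => hfix a ⟨le_rfl, ha.trans hb⟩ (by simp [(h1 a ⟨le_rfl, ha⟩).1, h])
  have p1 : 0 < δ₁ := lt_of_le_of_ne (by linarith) n1.symm
  have key : b + δ₂ ≤ a + δ₁ := by
    by_contra! hlt
    set w := max (a + δ₁) (y + δ₂) with hw
    have w1 : w - δ₁ ∈ Ico a y :=
      ⟨by linarith [le_max_left (a + δ₁) (y + δ₂)],
        sub_lt_iff_lt_add.2 (max_lt (by linarith) (by linarith))⟩
    have w2 : w - δ₂ ∈ Ico y b :=
      ⟨by linarith [le_max_right (a + δ₁) (y + δ₂)],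
        sub_lt_iff_lt_add.2 (max_lt (by linarith) (by linarith))⟩
    have heq : w - δ₁ = w - δ₂ := hinj ⟨w1.1, w1.2.trans hb⟩ ⟨ha.le.trans w2.1, w2.2⟩ (by
      rw [(h1 _ w1).1, (h2 _ w2).1]; ring)
    linarith [w1.2, w2.1]
  constructor <;> linarith

/-- An exchange of two intervals without periodic points is an irrational rotation. -/
lemma isIrrationalRotation_of_exchange {a b y : ℝ} {R : ℝ → ℝ} (hy : y ∈ Ioo a b)
    (hmaps : MapsTo R (Ico a b) (Ico a b))
    (h1 : ∀ z ∈ Ico a y, R z = z + (b - y)) (h2 : ∀ z ∈ Ico y b, R z = z + (a - y))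
    (hper : ∀ q : ℕ, 1 ≤ q → R^[q] a ≠ a) : IsIrrationalRotation R (Ico a b) := by
  have hab : a < b := hy.1.trans hy.2
  have hne : b - a ≠ 0 := (sub_pos.2 hab).ne'
  have hrot : ∀ z ∈ Ico a b,
      toCircle a b (R z) = toCircle a b z + (((b - y) / (b - a) : ℝ) : UnitAddCircle) := by
    intro z hz
    simp only [toCircle]
    rw [← AddCircle.coe_add]
    rcases lt_or_ge z y with h | h
    · rw [h1 z ⟨hz.1, h⟩]
      congr 1
      field_simp
      ring
    · rw [h2 z ⟨h, hz.2⟩, show (z - a) / (b - a) + (b - y) / (b - a) =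
        (z + (a - y) - a) / (b - a) + 1 by field_simp; ring, AddCircle.coe_add,
        AddCircle.coe_period, add_zero]
  refine ⟨a, b, (b - y) / (b - a), hab, rfl, ?_, fun z hz => ⟨hmaps hz, hrot z hz⟩⟩
  rintro ⟨c, hc⟩
  have haJ : a ∈ Ico a b := ⟨le_rfl, hab⟩
  have hiter : ∀ q : ℕ, toCircle a b (R^[q] a) =
      toCircle a b a + q • (((b - y) / (b - a) : ℝ) : UnitAddCircle) := by
    intro q
    induction q with
    | zero => simp
    | succ q ih =>
      rw [Function.iterate_succ_apply', hrot _ (hmaps.iterate q haJ), ih, succ_nsmul, add_assoc]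
  refine hper c.den c.den_pos ((bijOn_toCircle hab).injOn (hmaps.iterate _ haJ) haJ ?_)
  rw [hiter, ← hc, ← AddCircle.coe_nsmul, nsmul_eq_mul, add_eq_left, AddCircle.coe_eq_zero_iff]
  refine ⟨c.num, ?_⟩
  rw [zsmul_one]
  exact_mod_cast (Rat.den_mul_eq_num c).symm

/-! ### Return maps to components of the attractor -/

section Component

variable {r : ℕ} {p : Param r} {a b : ℝ}

/-- A point of `(a, b)` whose orbit meets a discontinuity of `T` before it returns to `[a, b)`. -/
def IsBreak (p : Param r) (a b y : ℝ) : Prop :=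
  y ∈ Ioo a b ∧ ∃ (s : ℕ) (j : Fin (r - 1)), (toMap p)^[s] y = p.2 j ∧
    ∀ t, 1 ≤ t → t ≤ s → (toMap p)^[t] y ∉ Ico a b

/-- The return map to a component has at most one discontinuity: the invariants of
`exists_invariant` determine which discontinuity of `T` can be met, and by injectivity of `T` it is
met, before the return, by the orbit of one point only. -/
lemma IsBreak.unique (hr : 2 ≤ r) (hp : p ∈ ITM r) (hfin : IsFiniteType p) (hg : IsGeneric p)
    (hJ : Ico a b ⊆ attractor p) {y y' : ℝ} (h : IsBreak p a b y) (h' : IsBreak p a b y') :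
    y = y' := by
  obtain ⟨hy, s, j, hs, hsJ⟩ := h
  obtain ⟨hy', s', j', hs', hsJ'⟩ := h'
  wlog hle : s ≤ s' generalizing y y' s s' j j'
  · exact (this hy' s' j' hs' hsJ' hy s j hs hsJ (le_of_not_ge hle)).symm
  have hmaps : MapsTo (toMap p) (attractor p) (attractor p) :=
    mapsTo_iff_image_subset.2 hfin.image_attractor.subset
  have hyJ : y ∈ Ico a b := Ioo_subset_Ico_self hy
  have hyJ' : y' ∈ Ico a b := Ioo_subset_Ico_self hy'
  have hjj : j = j' := by
    obtain ⟨N, hN1, hN2, hN3⟩ := exists_invariant hr hp hfin hg j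
    have hiter : ∀ (n : ℕ) x, x ∈ attractor p → N ((toMap p)^[n] x) = N x := by
      intro n
      induction n with
      | zero => simp
      | succ n ih =>
        intro x hx
        rw [Function.iterate_succ_apply', hN1 _ (hmaps.iterate n hx), ih x hx]
    have hconst : ∀ z ∈ Ico a b, N z = N a := fun z hz =>
      hN2 a z hz.1 fun w hw => hJ ⟨hw.1, hw.2.trans_lt hz.2⟩
    have e1 := hiter s y (hJ hyJ)
    have e2 := hiter s' y' (hJ hyJ')
    rw [hs, hN3 j (hs ▸ hmaps.iterate s (hJ hyJ)), hconst y hyJ] at e1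
    rw [hs', hN3 j' (hs' ▸ hmaps.iterate s' (hJ hyJ')), hconst y' hyJ'] at e2
    by_contra hne
    simp [Ne.symm hne, ← e1] at e2
  subst hjj
  have heq := iterate_sub_eq (hfin.injOn_attractor hr hp) hmaps (hJ hyJ) (hJ hyJ') hle
    (hs.trans hs'.symm)
  rcases Nat.eq_zero_or_pos (s' - s) with h0 | h0
  · rwa [h0] at heq
  · exact absurd (heq ▸ hyJ) (hsJ' _ h0 (Nat.sub_le _ _))

/-- Up to its first return, an interval without interior break points is moved rigidly. -/
lemma exists_iterate_eq_add (hr : 2 ≤ r) (hp : p ∈ ITM r) (hJ : Ico a b ⊆ Ico 0 1) {u v : ℝ}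
    (huv : u < v) (hau : a ≤ u) (hvb : v ≤ b) (hbr : ∀ y ∈ Ioo u v, ¬IsBreak p a b y) (k : ℕ)
    (hk : ∀ t, 1 ≤ t → t < k → ∀ z ∈ Ico u v, (toMap p)^[t] z ∉ Ico a b) :
    ∃ δ, ∀ z ∈ Ico u v, (toMap p)^[k] z = z + δ := by
  induction k with
  | zero => exact ⟨0, by simp⟩
  | succ k ih =>
    obtain ⟨δ, hδ⟩ := ih fun t h1 h2 => hk t h1 (by omega)
    have hI : ∀ z ∈ Ico u v, z + δ ∈ Ico (0 : ℝ) 1 := fun z hz =>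
      hδ z hz ▸ (mapsTo_toMap hr hp).iterate k (hJ ⟨hau.trans hz.1, hz.2.trans_le hvb⟩)
    obtain ⟨i, hi⟩ := exists_mem_piece (p := p) hr (hI u ⟨le_rfl, huv⟩)
    refine ⟨δ + p.1 i, fun z hz => ?_⟩
    have hzi : z + δ ∈ piece p i := by
      refine ⟨hi.1.trans (by linarith [hz.1]), ?_⟩
      by_contra! hge
      have hir : (i : ℕ) < r - 1 := by
        by_contra! hir
        have : (i : ℕ) + 1 = r := by omega
        rw [this, breakpoint_self hr] at hge
        exact absurd (hI z hz).2 (not_lt.2 hge)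
      have hβ : breakpoint p (i + 1) = p.2 ⟨i, hir⟩ := breakpoint_succ ⟨i, hir⟩
      have hiu := hi.2
      rw [hβ] at hge hiu
      have hy : p.2 ⟨i, hir⟩ - δ ∈ Ioo u v := ⟨by linarith, by linarith [hz.2]⟩
      refine hbr _ hy ⟨⟨hau.trans_lt hy.1, hy.2.trans_le hvb⟩, k, ⟨i, hir⟩, ?_, ?_⟩
      · rw [hδ _ (Ioo_subset_Ico_self hy)]
        ring
      · exact fun t h1 h2 => hk t h1 (by omega) _ (Ioo_subset_Ico_self hy)
    rw [Function.iterate_succ_apply', hδ z hz, toMap_of_mem hp hzi, add_assoc]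

/-- Some point of an interval without interior break points returns: otherwise all images of the
interval would be disjoint and of the same length. -/
lemma exists_iterate_mem (hr : 2 ≤ r) (hp : p ∈ ITM r) (hfin : IsFiniteType p)
    (hJ : Ico a b ⊆ attractor p) {u v : ℝ} (huv : u < v) (hau : a ≤ u) (hvb : v ≤ b)
    (hbr : ∀ y ∈ Ioo u v, ¬IsBreak p a b y) :
    ∃ k, 1 ≤ k ∧ ∃ z ∈ Ico u v, (toMap p)^[k] z ∈ Ico a b := by
  by_contra! hno
  have hI := attractor_subset_Ico hr hp
  have hmaps : MapsTo (toMap p) (attractor p) (attractor p) :=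
    mapsTo_iff_image_subset.2 hfin.image_attractor.subset
  have huvJ : Ico u v ⊆ Ico a b := Ico_subset_Ico hau hvb
  choose δ hδ using fun k => exists_iterate_eq_add hr hp (hJ.trans hI) huv hau hvb hbr k
    fun t h1 _ z hz => hno t h1 z hz
  have hsub : ∀ k, Ico (u + δ k) (v + δ k) ⊆ Ico 0 1 := by
    intro k w hw
    have hw' : w - δ k ∈ Ico u v := ⟨by linarith [hw.1], by linarith [hw.2]⟩
    have := hδ k _ hw'
    rw [sub_add_cancel] at this
    exact this ▸ hI (hmaps.iterate k (hJ (huvJ hw')))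
  have hvol : ∀ k, (volume.restrict (Ico (0 : ℝ) 1)) (Ico (u + δ k) (v + δ k)) =
      ENNReal.ofReal (v - u) := fun k => by
    rw [Measure.restrict_eq_self _ (hsub k), Real.volume_Ico]
    congr 1
    ring
  obtain ⟨k, l, hkl, w, hwk, hwl⟩ := exists_nonempty_inter_of_measure_univ_lt_tsum_measure
    (volume.restrict (Ico (0 : ℝ) 1)) (s := fun k => Ico (u + δ k) (v + δ k))
    (fun k => measurableSet_Ico.nullMeasurableSet) (by
      simp only [hvol]
      rw [ENNReal.tsum_const_eq_top_of_ne_zero (by simpa using huv)]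
      simp)
  wlog hlt : k < l generalizing k l
  · exact this l k hkl.symm hwl hwk (lt_of_le_of_ne (not_lt.1 hlt) hkl.symm)
  have hk' : w - δ k ∈ Ico u v := ⟨by linarith [hwk.1], by linarith [hwk.2]⟩
  have hl' : w - δ l ∈ Ico u v := ⟨by linarith [hwl.1], by linarith [hwl.2]⟩
  have heq := iterate_sub_eq (hfin.injOn_attractor hr hp) hmaps (hJ (huvJ hk')) (hJ (huvJ hl'))
    hlt.le (by rw [hδ k _ hk', hδ l _ hl']; ring)
  exact hno (l - k) (by omega) _ hl' (heq ▸ huvJ hk')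

/-- The return map is a translation on every interval without interior break points. -/
lemma exists_returnMap_eq_add (hr : 2 ≤ r) (hp : p ∈ ITM r) (hfin : IsFiniteType p)
    (hJ : Ico a b ⊆ attractor p)
    (hmax : ∀ u v, Ico u v ⊆ attractor p → (Ico u v ∩ Ico a b).Nonempty → Ico u v ⊆ Ico a b)
    {u v : ℝ} (huv : u < v) (hau : a ≤ u) (hvb : v ≤ b)
    (hbr : ∀ y ∈ Ioo u v, ¬IsBreak p a b y) :
    ∃ δ, ∀ z ∈ Ico u v, (∃ k, 1 ≤ k ∧ (toMap p)^[k] z ∈ Ico a b) ∧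
      returnMap (toMap p) (Ico a b) z = z + δ ∧ z + δ ∈ Ico a b := by
  classical
  have hI := attractor_subset_Ico hr hp
  have hmaps : MapsTo (toMap p) (attractor p) (attractor p) :=
    mapsTo_iff_image_subset.2 hfin.image_attractor.subset
  have hex := exists_iterate_mem hr hp hfin hJ huv hau hvb hbr
  obtain ⟨hk1, z₀, hz₀, hz₀J⟩ := Nat.find_spec hex
  have hmin : ∀ t, 1 ≤ t → t < Nat.find hex → ∀ z ∈ Ico u v, (toMap p)^[t] z ∉ Ico a b :=
    fun t h1 h2 z hz hzJ => Nat.find_min hex h2 ⟨h1, z, hz, hzJ⟩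
  obtain ⟨δ, hδ⟩ := exists_iterate_eq_add hr hp (hJ.trans hI) huv hau hvb hbr _ hmin
  have hsub : Ico (u + δ) (v + δ) ⊆ Ico a b := by
    refine hmax _ _ (fun w hw => ?_) ⟨z₀ + δ, ⟨by linarith [hz₀.1], by linarith [hz₀.2]⟩, ?_⟩
    · have hw' : w - δ ∈ Ico u v := ⟨by linarith [hw.1], by linarith [hw.2]⟩
      have := hδ _ hw'
      rw [sub_add_cancel] at this
      exact this ▸ hmaps.iterate _ (hJ (Ico_subset_Ico hau hvb hw'))
    · rwa [← hδ z₀ hz₀]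
  refine ⟨δ, fun z hz => ?_⟩
  have hzJ : z + δ ∈ Ico a b := hsub ⟨by linarith [hz.1], by linarith [hz.2]⟩
  have hzJ' : (toMap p)^[Nat.find hex] z ∈ Ico a b := by rwa [hδ z hz]
  refine ⟨⟨_, hk1, hzJ'⟩, ?_, hzJ⟩
  rw [returnMap_eq hk1 hzJ' fun t h1 h2 => hmin t h1 h2 z hz, hδ z hz]

/-- The return map to a component of the attractor of a generic finite type map is an irrational
rotation. -/
theorem isIrrationalRotation_returnMap (hr : 2 ≤ r) (hp : p ∈ ITM r) (hfin : IsFiniteType p)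
    (hg : IsGeneric p) (hab : a < b) (hJ : Ico a b ⊆ attractor p)
    (hmax : ∀ u v, Ico u v ⊆ attractor p → (Ico u v ∩ Ico a b).Nonempty → Ico u v ⊆ Ico a b) :
    Returns (toMap p) (Ico a b) ∧
      IsIrrationalRotation (returnMap (toMap p) (Ico a b)) (Ico a b) := by
  have hmaps : MapsTo (toMap p) (attractor p) (attractor p) :=
    mapsTo_iff_image_subset.2 hfin.image_attractor.subset
  have hper : Returns (toMap p) (Ico a b) → ∀ z ∈ Ico a b, ∀ q : ℕ, 1 ≤ q →
      (returnMap (toMap p) (Ico a b))^[q] z ≠ z := by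
    intro hret z hz q hq
    obtain ⟨m, hm, h, -⟩ := exists_iterate_returnMap_eq hret hz q
    rw [h]
    exact hg.iterate_ne hr hp (attractor_subset_Ico hr hp (hJ hz)) (hq.trans hm)
  have haJ : a ∈ Ico a b := ⟨le_rfl, hab⟩
  by_cases hy : ∃ y, IsBreak p a b y
  · obtain ⟨y, hy⟩ := hy
    have huniq : ∀ z, IsBreak p a b z → z = y := fun z hz => hz.unique hr hp hfin hg hJ hy
    have hyab := hy.1
    obtain ⟨δ₁, h1⟩ := exists_returnMap_eq_add hr hp hfin hJ hmax hyab.1 le_rfl hyab.2.le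
      fun z hz hb => hz.2.ne (huniq z hb)
    obtain ⟨δ₂, h2⟩ := exists_returnMap_eq_add hr hp hfin hJ hmax hyab.2 hyab.1.le le_rfl
      fun z hz hb => hz.1.ne' (huniq z hb)
    have hret : Returns (toMap p) (Ico a b) := fun z hz => by
      rcases lt_or_ge z y with h | h
      · exact (h1 z ⟨hz.1, h⟩).1
      · exact (h2 z ⟨h, hz.2⟩).1
    obtain ⟨rfl, rfl⟩ := exchange_of_injOn hyab
      (injOn_returnMap (hfin.injOn_attractor hr hp) hmaps hJ hret)
      (fun z hz => hper hret z hz 1 le_rfl) (fun z hz => (h1 z hz).2) (fun z hz => (h2 z hz).2)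
    exact ⟨hret, isIrrationalRotation_of_exchange hyab (fun z hz => (returnTime_spec (hret z hz)).2)
      (fun z hz => (h1 z hz).2.1) (fun z hz => (h2 z hz).2.1) (hper hret a haJ)⟩
  · obtain ⟨δ, h⟩ := exists_returnMap_eq_add hr hp hfin hJ hmax hab le_rfl le_rfl
      fun z _ hb => hy ⟨z, hb⟩
    have h0 := eq_zero_of_add_mem_Ico hab fun z hz => (h z hz).2.2
    refine absurd ?_ (hper (fun z hz => (h z hz).1) a haJ 1 le_rfl)
    rw [Function.iterate_one, (h a haJ).2.1, h0, add_zero]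

theorem IsGeneric.correspondsToIrrationalRotation (hg : IsGeneric p) (hr : 2 ≤ r) (hp : p ∈ ITM r)
    (hfin : IsFiniteType p) : CorrespondsToIrrationalRotation p := by
  refine ⟨hfin, ?_⟩
  rintro J ⟨x, hx, hJ⟩
  have hI := attractor_subset_Ico hr hp
  obtain ⟨a, b, hab, hJ'⟩ :=
    (hfin.isElementary_attractor hr hp).exists_connectedComponentIn_eq_Ico
      (Metric.isBounded_Ico 0 1 |>.subset hI) hx
  rw [hJ, hJ']
  refine isIrrationalRotation_returnMap hr hp hfin hg hab
    (hJ' ▸ connectedComponentIn_subset _ _) fun u v hsub ⟨w, hw, hwJ⟩ => ?_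
  rw [← hJ'] at hwJ ⊢
  rw [connectedComponentIn_eq hwJ]
  exact isPreconnected_Ico.subset_connectedComponentIn hw hsub

end Component

end IntervalTranslation
end

theorem mainTheorem6
    (hBK : IntervalTranslation.BoshernitzanKornfeldConjecture)
    (r : ℕ) (hr : 2 ≤ r) :
    ∀ᵐ p : IntervalTranslation.Param r ∂(MeasureTheory.volume),
      p ∈ IntervalTranslation.ITM r →
        IntervalTranslation.CorrespondsToIrrationalRotation p := by
  have h := measure_eq_zero_iff_ae_notMem.1 (hBK r hr)
  filter_upwards [h, IntervalTranslation.ae_isGeneric r] with p hp hg hpI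
  exact hg.correspondsToIrrationalRotation hr hpI
    (IntervalTranslation.isFiniteType_of_not_isInfiniteType hr hpI fun hinf => hp ⟨hpI, hinf⟩)
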